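/- Let $M$ be a compact smooth Riemannian manifold, $\varphi:M\to M$ a $C^2$ diffeomorphism, and $TM=E\oplus F$ a $D\varphi$-invariant splitting into $C^1$ distributions of constant ranks. For $k\ge 1$ let $s^k_1\le\dots\le s^k_d$ and $s^{-k}_1\ge\dots\ge s^{-k}_d$ ($d=\dim E$) be the singular values of $D\varphi^{k}_x|_{E}$ and $D\varphi^{-k}_x|_{E}$, that is, the square roots of the eigenvalues of $(D\varphi^{\pm k}_x|_E)^{\dagger}D\varphi^{\pm k}_x|_E$, counted with multiplicity. For a subspace $S\subseteq T_xM$, an Oseledets splitting of $S$ with exponents $\lambda_1<\dots<\lambda_n$ is a decomposition $S=E_1\oplus\dots\oplus E_n$ into nonzero subspaces such that $\lim_{k\to\pm\infty}\frac1k\ln\|D\varphi^k_xv\|=\lambda_i$ for every $i$ and every $0\ne v\in E_i$. The point $x$ is Lyapunov regular if $T_xM$ has an Oseledets splitting $W_1\oplus\dots\oplus W_p$ with exponents $\chi_1<\dots<\chi_p$ for which moreover $\lim_{k\to\pm\infty}\frac1k\ln|\det D\varphi^k_x|=\sum_{j}\chi_j\dim W_j$. Let $x\in M$ be Lyapunov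 regular. Then $E(x)$ has an Oseledets splitting. Moreover, if $E(x)=E_1\oplus\dots\oplus E_n$ is an Oseledets splitting with exponents $\lambda_1<\dots<\lambda_n$, and $d_i=\sum_{j\le i}\dim E_j$ for $0\le i\le n$, then for every $i=1,\dots,n$ and every $d_{i-1}<\ell\le d_i$, \[ \lim_{k\to+\infty}\frac1k\ln s^k_\ell=\lambda_i\qquad\text{and}\qquad \lim_{k\to-\infty}\frac1k\ln s^k_\ell=\lambda_i . \] -/

import Mathlib

open Filter Topology Manifold Bundle
open scoped ContDiff

/-- Tangent spaces of an `m`-dimensional manifold are finite-dimensional. -/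
instance tangentSpace_finiteDimensional {m : ℕ} {M : Type*} [TopologicalSpace M]
    [ChartedSpace (EuclideanSpace ℝ (Fin m)) M] (x : M) :
    FiniteDimensional ℝ (TangentSpace (𝓡 m) x) :=
  inferInstanceAs (FiniteDimensional ℝ (EuclideanSpace ℝ (Fin m)))

noncomputable section

namespace LyapunovSing

/-- `E` is a `C¹` distribution of rank `d`: near each point it is spanned by a pointwise linearly
independent family of `d` vector fields of class `C¹`. -/
def IsC1Distribution {m : ℕ} {M : Type*} [TopologicalSpace M]
    [ChartedSpace (EuclideanSpace ℝ (Fin m)) M] [IsManifold (𝓡 m) ∞ M]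
    (d : ℕ) (E : ∀ x : M, Submodule ℝ (TangentSpace (𝓡 m) x)) : Prop :=
  ∀ x₀ : M, ∃ U : Set M, IsOpen U ∧ x₀ ∈ U ∧
    ∃ X : Fin d → ∀ x : M, TangentSpace (𝓡 m) x,
      (∀ i, ContMDiffOn (𝓡 m) (𝓡 m).tangent 1
        (fun x => (⟨x, X i x⟩ : TangentBundle (𝓡 m) M)) U) ∧
      ∀ x ∈ U, LinearIndependent ℝ (fun i => X i x) ∧
        Submodule.span ℝ (Set.range fun i => X i x) = E x

/-- `Dφ` maps `E(x)` onto `E(φ(x))` for every `x`. -/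
def IsInvariantDistribution {m : ℕ} {M : Type*} [TopologicalSpace M]
    [ChartedSpace (EuclideanSpace ℝ (Fin m)) M]
    (φ : M ≃ₘ^2⟮𝓡 m, 𝓡 m⟯ M) (E : ∀ x : M, Submodule ℝ (TangentSpace (𝓡 m) x)) : Prop :=
  ∀ x : M, (E x).map (mfderiv (𝓡 m) (𝓡 m) φ x).toLinearMap = E (φ x)

/-- The iterate `φ^k`, for `k : ℤ`, as a bijection of `M`. -/
def iter {m : ℕ} {M : Type*} [TopologicalSpace M]
    [ChartedSpace (EuclideanSpace ℝ (Fin m)) M]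
    (φ : M ≃ₘ^2⟮𝓡 m, 𝓡 m⟯ M) (k : ℤ) : Equiv.Perm M :=
  (φ.toEquiv : Equiv.Perm M) ^ k

/-- The derivative `Dφ^k_x : T_x M → T_{φ^k(x)} M` of the `k`-th iterate, `k : ℤ`. -/
def Diter {m : ℕ} {M : Type*} [TopologicalSpace M]
    [ChartedSpace (EuclideanSpace ℝ (Fin m)) M]
    (φ : M ≃ₘ^2⟮𝓡 m, 𝓡 m⟯ M) (k : ℤ) (x : M) :
    TangentSpace (𝓡 m) x →ₗ[ℝ] TangentSpace (𝓡 m) (iter φ k x) :=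
  (mfderiv (𝓡 m) (𝓡 m) (iter φ k) x).toLinearMap

/-- The sequence `a`, indexed by `ℤ`, tends to `c` both as `k → +∞` and as `k → -∞`. -/
def TendstoBothEnds (a : ℤ → ℝ) (c : ℝ) : Prop :=
  Tendsto a atTop (𝓝 c) ∧ Tendsto a atBot (𝓝 c)

section Riemannian

variable {m : ℕ} {M : Type*} [TopologicalSpace M]
  [ChartedSpace (EuclideanSpace ℝ (Fin m)) M] [IsManifold (𝓡 m) ∞ M]
  [RiemannianBundle (fun x : M => TangentSpace (𝓡 m) x)]

/-- The `ℓ`-th singular value `s^k_ℓ`, `1 ≤ ℓ ≤ dim S`, of the restriction of `Dφ^k_x` to a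
subspace `S` of `T_x M`, in increasing order for `k ≥ 0` and in decreasing order for `k < 0`:
`s^k_1 ≤ s^k_2 ≤ …` and `s^{-k}_1 ≥ s^{-k}_2 ≥ …` for `k ≥ 1`.
`LinearMap.singularValues` is the decreasing list, numbered from `0`, of the square roots of the
eigenvalues of `A† A`. Since `⟪A† A u, v⟫ = ⟪A u, A v⟫`, the operator `A† A` on `S` does not depend
on whether the codomain of `A` is `T_{φ^k(x)} M` or the image of `S`. -/
def singVal (φ : M ≃ₘ^2⟮𝓡 m, 𝓡 m⟯ M) (x : M) (S : Submodule ℝ (TangentSpace (𝓡 m) x))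
    (k : ℤ) (ℓ : ℕ) : ℝ :=
  if 0 ≤ k then
    ((Diter φ k x).domRestrict S).singularValues (Module.finrank ℝ S - ℓ)
  else
    ((Diter φ k x).domRestrict S).singularValues (ℓ - 1)

/-- The tangent vector `v` at `x` has the two-sided Lyapunov exponent `c`:
`(1/k) log ‖Dφ^k_x v‖ → c` as `k → ±∞`. -/
def HasLyapunovExponent (φ : M ≃ₘ^2⟮𝓡 m, 𝓡 m⟯ M) (x : M) (v : TangentSpace (𝓡 m) x)
    (c : ℝ) : Prop :=
  TendstoBothEnds (fun k => 1 / (k : ℝ) * Real.log ‖Diter φ k x v‖) c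

/-- `S = E₁ ⊕ ⋯ ⊕ E_n` is an Oseledets splitting of the subspace `S` of `T_x M`, with Lyapunov
exponents `λ₁ < ⋯ < λ_n`: the `E_i` are nonzero, and each nonzero vector of `E_i` has the two-sided
Lyapunov exponent `λ_i`. (The splitting along the orbit is given by the images `Dφ^k_x E_i`.) -/
structure IsOseledetsSplitting (φ : M ≃ₘ^2⟮𝓡 m, 𝓡 m⟯ M) (x : M)
    (S : Submodule ℝ (TangentSpace (𝓡 m) x)) {n : ℕ}
    (E : Fin n → Submodule ℝ (TangentSpace (𝓡 m) x)) (lam : Fin n → ℝ) : Prop where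
  strictMono : StrictMono lam
  ne_bot : ∀ i, E i ≠ ⊥
  iSupIndep : iSupIndep E
  iSup_eq : ⨆ i, E i = S
  exponent : ∀ i, ∀ v ∈ E i, v ≠ 0 → HasLyapunovExponent φ x v (lam i)

/-- `x` is Lyapunov regular: `T_x M` has an Oseledets splitting `W₁ ⊕ ⋯ ⊕ W_p` with exponents
`χ₁ < ⋯ < χ_p`, and `(1/k) log |det Dφ^k_x| → ∑ⱼ χⱼ dim Wⱼ` as `k → ±∞`. Here `normDet` is the
absolute value of the determinant in orthonormal bases. -/
def IsLyapunovRegular (φ : M ≃ₘ^2⟮𝓡 m, 𝓡 m⟯ M) (x : M) : Prop :=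
  ∃ (p : ℕ) (W : Fin p → Submodule ℝ (TangentSpace (𝓡 m) x)) (χ : Fin p → ℝ),
    IsOseledetsSplitting φ x ⊤ W χ ∧
    TendstoBothEnds (fun k => 1 / (k : ℝ) * Real.log (Diter φ k x).normDet)
      (∑ j, χ j * (Module.finrank ℝ (W j) : ℝ))

end Riemannian

end LyapunovSing

end

/-! Regularity says that the determinant grows as fast as the product of the norms of the images of
an adapted basis, so these images degenerate at most subexponentially. Quantitatively, Hadamard's
inequality for the basis with one vector replaced by `v` (`normDet_mul_abs_coord_le`) gives
`|b.coord a v| * exp (N k * (χ a - ε)) ≤ ‖A k v‖` eventually, uniformly in `v`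
(`eventually_abs_coord_mul_exp_le`).

For the existence of the splitting: a vector growing at most at rate `c` in the future and `-c` in
the past has only components of exponent `c`. By compactness the projections onto `E` along `F` are
uniformly bounded, and by invariance they commute with the derivatives. The `E`-component of an
adapted basis vector thus grows no faster than that vector in either time direction, and stays in
the same `W j`. Hence `E x` is the sum of the `E x ⊓ W j`.

For the singular values: by the same coordinate bound, vectors in the sum of the pieces of exponent
at least `λ_i` grow uniformly at rate at least `λ_i`, and those in the sum of the pieces of exponent
at most `λ_i` grow uniformly at rate at most `λ_i`. The min-max principle and a dimension count
conclude. The past is the same argument with time reversed and exponents negated. -/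

namespace LyapunovSing

/-! ### Min-max bounds for singular values, and Hadamard's inequality. -/

section SingularValues

variable {V U : Type*} [NormedAddCommGroup V] [InnerProductSpace ℝ V]
  [NormedAddCommGroup U] [InnerProductSpace ℝ U]

theorem norm_sq_eq_sum_coord {n : ℕ} (e : OrthonormalBasis (Fin n) ℝ V) (v : V) :
    ‖v‖ ^ 2 = ∑ j, (e.repr v j) ^ 2 := by
  rw [← e.repr.norm_map, EuclideanSpace.norm_sq_eq]
  simp

/-- Hadamard's inequality for the determinant in an orthonormal basis. -/
theorem abs_det_le_prod_norm {n : ℕ} (o : OrthonormalBasis (Fin n) ℝ U) (w : Fin n → U) :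
    |o.toBasis.det w| ≤ ∏ i, ‖w i‖ := by
  have : Fact (Module.finrank ℝ U = n) := ⟨by simpa using Module.finrank_eq_card_basis o.toBasis⟩
  rw [← o.toBasis.orientation.volumeForm_robust' o w]
  exact o.toBasis.orientation.abs_volumeForm_apply_le w

/-- Cramer's rule: both sides are linear in `v`, and on a basis vector other than `b a` the
determinant has a repeated entry. -/
theorem det_update_self {n : ℕ} (b : Module.Basis (Fin n) ℝ V) (a : Fin n) (v : V) :
    b.det (Function.update b a v) = b.coord a v := by
  have : b.det.toMultilinearMap.toLinearMap b a = b.coord a := by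
    refine b.ext fun j => ?_
    rcases eq_or_ne j a with rfl | hj
    · simp [MultilinearMap.toLinearMap, b.det_self]
    · have : b.det (Function.update b a (b j)) = 0 :=
        b.det.map_eq_zero_of_eq _ (by simp [hj]) hj
      simp [MultilinearMap.toLinearMap, this, hj]
  exact LinearMap.congr_fun this v

variable [FiniteDimensional ℝ V] [FiniteDimensional ℝ U]

/-- A subspace of dimension larger than the number of given coordinates contains a nonzero vector
for which these coordinates vanish. -/
theorem exists_mem_ne_zero_coord_eq_zero {ι : Type*} (b : Module.Basis ι ℝ V)
    (P : Submodule ℝ V) (J : Finset ι) (hJ : J.card < Module.finrank ℝ P) :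
    ∃ v ∈ P, v ≠ 0 ∧ ∀ j ∈ J, b.coord j v = 0 := by
  let f : P →ₗ[ℝ] (J → ℝ) := LinearMap.pi fun j => (b.coord j).domRestrict P
  have hf : LinearMap.ker f ≠ ⊥ := LinearMap.ker_ne_bot_of_finrank_lt (by simpa using hJ)
  obtain ⟨v, hv, hv0⟩ := Submodule.exists_mem_ne_zero_of_ne_bot hf
  refine ⟨v, v.2, by simpa using hv0, fun j hj => ?_⟩
  exact congrFun (LinearMap.mem_ker.1 hv) ⟨j, hj⟩

/-- The norm of `T v` in terms of the coordinates of `v` in a basis of right singular vectors. -/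
theorem norm_sq_eq_sum_singularValues (T : V →ₗ[ℝ] U) (v : V) :
    ‖T v‖ ^ 2 = ∑ j : Fin (Module.finrank ℝ V), T.singularValues j ^ 2 *
      ((T.isSymmetric_adjoint_comp_self.eigenvectorBasis rfl).repr v j) ^ 2 := by
  set e := T.isSymmetric_adjoint_comp_self.eigenvectorBasis rfl with he
  have h1 : ‖T v‖ ^ 2 = inner ℝ ((T.adjoint ∘ₗ T) v) v := by
    rw [← real_inner_self_eq_norm_sq, LinearMap.comp_apply, LinearMap.adjoint_inner_left]
  rw [h1, ← e.repr.inner_map_map, PiLp.inner_apply]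
  refine Finset.sum_congr rfl fun j _ => ?_
  rw [he, T.isSymmetric_adjoint_comp_self.eigenvectorBasis_apply_self_apply rfl,
    T.sq_singularValues_fin rfl]
  simp
  ring

/-- Min-max upper bound for singular values. -/
theorem singularValues_le_of_forall_norm_le (T : V →ₗ[ℝ] U) (P : Submodule ℝ V) {C : ℝ}
    (hC : 0 ≤ C) (h : ∀ v ∈ P, ‖T v‖ ≤ C * ‖v‖) {i : ℕ}
    (hi : Module.finrank ℝ V ≤ i + Module.finrank ℝ P) : T.singularValues i ≤ C := by
  by_cases hn : Module.finrank ℝ V ≤ i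
  · rwa [T.singularValues_of_finrank_le hn]
  push Not at hn
  set e := T.isSymmetric_adjoint_comp_self.eigenvectorBasis rfl with he
  -- Only `finrank V - i - 1 < finrank P` coordinates are killed. The singular values that still
  -- contribute to `‖T v‖` are at least the `i`-th.
  obtain ⟨v, hvP, hv0, hv⟩ := exists_mem_ne_zero_coord_eq_zero e.toBasis P
    (Finset.Ioi ⟨i, hn⟩) (by rw [Fin.card_Ioi]; simp; omega)
  have h2 : T.singularValues i ^ 2 * ‖v‖ ^ 2 ≤ ‖T v‖ ^ 2 := by
    rw [norm_sq_eq_sum_singularValues, norm_sq_eq_sum_coord e, Finset.mul_sum]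
    refine Finset.sum_le_sum fun j _ => ?_
    by_cases hj : (⟨i, hn⟩ : Fin _) < j
    · have : e.repr v j = 0 := by simpa using hv j (Finset.mem_Ioi.2 hj)
      simp [← he, this]
    · have : T.singularValues i ≤ T.singularValues j :=
        T.singularValues_antitone (by simpa [Fin.lt_def] using hj)
      have := T.singularValues_nonneg i
      gcongr
  have hvpos : 0 < ‖v‖ := norm_pos_iff.2 hv0
  have h3 : T.singularValues i * ‖v‖ ≤ ‖T v‖ := by
    refine le_of_sq_le_sq ?_ (norm_nonneg _)
    rwa [mul_pow]
  exact le_of_mul_le_mul_right (h3.trans (h v hvP)) hvpos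

/-- Max-min lower bound for singular values. -/
theorem le_singularValues_of_forall_le_norm (T : V →ₗ[ℝ] U) (P : Submodule ℝ V) {C : ℝ}
    (h : ∀ v ∈ P, C * ‖v‖ ≤ ‖T v‖) {i : ℕ}
    (hi : i < Module.finrank ℝ P) : C ≤ T.singularValues i := by
  have hn : i < Module.finrank ℝ V := hi.trans_le (Submodule.finrank_le P)
  set e := T.isSymmetric_adjoint_comp_self.eigenvectorBasis rfl with he
  -- Here the `i < finrank P` coordinates with the larger singular values are killed.
  obtain ⟨v, hvP, hv0, hv⟩ := exists_mem_ne_zero_coord_eq_zero e.toBasis P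
    (Finset.Iio ⟨i, hn⟩) (by rw [Fin.card_Iio]; simpa using hi)
  have h2 : ‖T v‖ ^ 2 ≤ T.singularValues i ^ 2 * ‖v‖ ^ 2 := by
    rw [norm_sq_eq_sum_singularValues, norm_sq_eq_sum_coord e, Finset.mul_sum]
    refine Finset.sum_le_sum fun j _ => ?_
    by_cases hj : j < (⟨i, hn⟩ : Fin _)
    · have : e.repr v j = 0 := by simpa using hv j (Finset.mem_Iio.2 hj)
      simp [← he, this]
    · have : T.singularValues j ≤ T.singularValues i :=
        T.singularValues_antitone (by simpa [Fin.lt_def] using hj)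
      have := T.singularValues_nonneg j
      gcongr
  have hvpos : 0 < ‖v‖ := norm_pos_iff.2 hv0
  have h3 : ‖T v‖ ≤ T.singularValues i * ‖v‖ := by
    refine le_of_sq_le_sq ?_ (mul_nonneg (T.singularValues_nonneg i) (norm_nonneg _))
    rwa [mul_pow]
  exact le_of_mul_le_mul_right ((h v hvP).trans h3) hvpos

/-- Each coordinate of `v` is controlled by `‖T v‖`, the images of the other basis vectors, and the
determinant. -/
theorem normDet_mul_abs_coord_le {n : ℕ} (o : OrthonormalBasis (Fin n) ℝ V)
    (hU : Module.finrank ℝ U = n) (b : Module.Basis (Fin n) ℝ V) (T : V →ₗ[ℝ] U)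
    (a : Fin n) (v : V) :
    |o.toBasis.det b| * T.normDet * |b.coord a v| ≤
      ‖T v‖ * ∏ j ∈ Finset.univ.erase a, ‖T (b j)‖ := by
  obtain ⟨o'⟩ : Nonempty (OrthonormalBasis (Fin n) ℝ U) := by
    subst hU; exact ⟨stdOrthonormalBasis ℝ U⟩
  -- A top-degree form is determined by its value on one basis; comparing its values on `o`, on `b`
  -- and on the updated `b` produces the three factors on the left.
  let f : V [⋀^Fin n]→ₗ[ℝ] ℝ := o'.toBasis.det.compLinearMap T
  have h1 : T.normDet = |f o| := by
    rw [T.normDet_eq_norm_det_toMatrix o o', Real.norm_eq_abs]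
    congr 1
    rw [AlternatingMap.compLinearMap_apply, Module.Basis.det_apply]
    congr 1
    ext i j
    simp [LinearMap.toMatrix_apply, Module.Basis.toMatrix_apply]
  have h2 : f b = f o * o.toBasis.det b := by
    conv_lhs => rw [f.eq_smul_basis_det o.toBasis]
    simp
  have h3 : f (Function.update b a v) = f b * b.coord a v := by
    conv_lhs => rw [f.eq_smul_basis_det b]
    rw [AlternatingMap.smul_apply, smul_eq_mul, det_update_self]
  calc |o.toBasis.det b| * T.normDet * |b.coord a v| = |f (Function.update b a v)| := by
        rw [h3, h2, h1, abs_mul, abs_mul]; ring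
    _ ≤ ∏ i, ‖T (Function.update b a v i)‖ := abs_det_le_prod_norm o' _
    _ = _ := by
        rw [← Finset.mul_prod_erase _ _ (Finset.mem_univ a)]
        congr 1
        · simp
        · refine Finset.prod_congr rfl fun j hj => ?_
          rw [Function.update_of_ne (Finset.ne_of_mem_erase hj)]

end SingularValues

/-! ### Exponential growth rates and regular bases. -/

section Growth

variable {κ : Type*} {l : Filter κ} {N : κ → ℝ}

/-- Growth is measured in an abstract time `N` tending to infinity along `l`, so that the future (`N
k = k`) and the past (`N k = -k`) share one argument. -/
theorem eventually_exp_le_of_tendsto (hN : Tendsto N l atTop) {f : κ → ℝ} (hf : ∀ k, 0 < f k)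
    {c : ℝ} (h : Tendsto (fun k => 1 / N k * Real.log (f k)) l (𝓝 c)) {ε : ℝ} (hε : 0 < ε) :
    ∀ᶠ k in l, Real.exp (N k * (c - ε)) ≤ f k := by
  filter_upwards [h.eventually_const_lt (show c - ε < c by linarith), hN.eventually_gt_atTop 0]
    with k hk hNk
  rw [← Real.le_log_iff_exp_le (hf k)]
  rw [one_div_mul_eq_div, lt_div_iff₀ hNk] at hk
  linarith

theorem eventually_le_exp_of_tendsto (hN : Tendsto N l atTop) {f : κ → ℝ} (hf : ∀ k, 0 < f k)
    {c : ℝ} (h : Tendsto (fun k => 1 / N k * Real.log (f k)) l (𝓝 c)) {ε : ℝ} (hε : 0 < ε) :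
    ∀ᶠ k in l, f k ≤ Real.exp (N k * (c + ε)) := by
  filter_upwards [h.eventually_lt_const (show c < c + ε by linarith), hN.eventually_gt_atTop 0]
    with k hk hNk
  rw [← Real.log_le_iff_le_exp (hf k)]
  rw [one_div_mul_eq_div, div_lt_iff₀ hNk] at hk
  linarith

theorem tendsto_of_eventually_exp_le_of_le_exp (hN : Tendsto N l atTop) {f : κ → ℝ} {c : ℝ}
    (h₁ : ∀ ε > 0, ∀ᶠ k in l, Real.exp (N k * (c - ε)) ≤ f k)
    (h₂ : ∀ ε > 0, ∀ᶠ k in l, f k ≤ Real.exp (N k * (c + ε))) :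
    Tendsto (fun k => 1 / N k * Real.log (f k)) l (𝓝 c) := by
  rw [Metric.tendsto_nhds]
  intro ε hε
  filter_upwards [h₁ (ε / 2) (half_pos hε), h₂ (ε / 2) (half_pos hε), hN.eventually_gt_atTop 0]
    with k hk₁ hk₂ hNk
  have hf : 0 < f k := (Real.exp_pos _).trans_le hk₁
  rw [← Real.le_log_iff_exp_le hf] at hk₁
  rw [← Real.log_le_iff_le_exp hf] at hk₂
  rw [Real.dist_eq, abs_lt, one_div_mul_eq_div]
  constructor
  · rw [lt_sub_iff_add_lt, lt_div_iff₀ hNk]; nlinarith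
  · rw [sub_lt_iff_lt_add, div_lt_iff₀ hNk]; nlinarith

theorem eventually_le_exp_mul (hN : Tendsto N l atTop) (C : ℝ) {ε : ℝ} (hε : 0 < ε) :
    ∀ᶠ k in l, C ≤ Real.exp (N k * ε) :=
  (Real.tendsto_exp_atTop.comp (hN.atTop_mul_const hε)).eventually_ge_atTop C

variable {V : Type*} [NormedAddCommGroup V] [InnerProductSpace ℝ V] [FiniteDimensional ℝ V]
  {U : κ → Type*} [∀ k, NormedAddCommGroup (U k)] [∀ k, InnerProductSpace ℝ (U k)]
  {A : ∀ k, V →ₗ[ℝ] U k} {n : ℕ}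
  {b : Module.Basis (Fin n) ℝ V} {χ : Fin n → ℝ}

/-- The basis `b` is regular, with exponents `χ`, for the maps `A k` with respect to the time `N k`:
the vector `b a` grows at the rate `χ a`, and the determinant grows at the rate `∑ a, χ a`. -/
structure IsRegularBasis (l : Filter κ) (N : κ → ℝ) (A : ∀ k, V →ₗ[ℝ] U k)
    (b : Module.Basis (Fin n) ℝ V) (χ : Fin n → ℝ) : Prop where
  tendsto_time : Tendsto N l atTop
  injective : ∀ k, Function.Injective (A k)
  finrank_eq : ∀ k, Module.finrank ℝ (U k) = n
  exponent : ∀ a, Tendsto (fun k => 1 / N k * Real.log ‖A k (b a)‖) l (𝓝 (χ a))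
  det : Tendsto (fun k => 1 / N k * Real.log (A k).normDet) l (𝓝 (∑ a, χ a))

theorem finrank_biSup_eq_sum {ι : Type*} {E : ι → Submodule ℝ V} (hind : iSupIndep E)
    (s : Finset ι) :
    Module.finrank ℝ (⨆ j ∈ s, E j : Submodule ℝ V) = ∑ j ∈ s, Module.finrank ℝ (E j) := by
  classical
  induction s using Finset.induction_on with
  | empty => simp
  | insert a s ha ih =>
    have hd : E a ⊓ ⨆ j ∈ s, E j = ⊥ :=
      (hind.disjoint_biSup (y := (s : Set ι)) (by simpa using ha)).eq_bot
    rw [Finset.iSup_insert, Finset.sum_insert ha, ← ih,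
      ← Submodule.finrank_sup_add_finrank_inf_eq, hd, finrank_bot, add_zero]

namespace IsRegularBasis

theorem norm_basis_pos (h : IsRegularBasis l N A b χ) (a : Fin n) (k : κ) : 0 < ‖A k (b a)‖ :=
  norm_pos_iff.2 ((map_ne_zero_iff _ (h.injective k)).2 (b.ne_zero a))

theorem normDet_pos (h : IsRegularBasis l N A b χ) (k : κ) : 0 < (A k).normDet :=
  lt_of_le_of_ne (A k).normDet_nonneg
    (Ne.symm (((A k).normDet_ne_zero_tfae.out 0 4).2 (h.injective k)))

/-- Needs only the triangle inequality in the basis: half of `ε` covers the growth of the basis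
vectors, half absorbs the norms of the coordinate functionals. -/
theorem eventually_norm_le (h : IsRegularBasis l N A b χ) {P : Submodule ℝ V} {c : ℝ}
    (hP : ∀ v ∈ P, ∀ a, c < χ a → b.coord a v = 0) {ε : ℝ} (hε : 0 < ε) :
    ∀ᶠ k in l, ∀ v ∈ P, ‖A k v‖ ≤ Real.exp (N k * (c + ε)) * ‖v‖ := by
  have hup : ∀ᶠ k in l, ∀ a, ‖A k (b a)‖ ≤ Real.exp (N k * (χ a + ε / 2)) :=
    eventually_all.2 fun a => eventually_le_exp_of_tendsto h.tendsto_time (h.norm_basis_pos a)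
      (h.exponent a) (half_pos hε)
  let K : Fin n → ℝ := fun a => ‖(b.coord a).toContinuousLinearMap‖
  filter_upwards [hup, eventually_le_exp_mul h.tendsto_time (∑ a, K a) (half_pos hε),
    h.tendsto_time.eventually_gt_atTop 0] with k hk₁ hk₂ hNk v hv
  have hterm : ∀ a, ‖b.coord a v • A k (b a)‖ ≤
      K a * (Real.exp (N k * (c + ε / 2)) * ‖v‖) := by
    intro a
    by_cases ha : c < χ a
    · rw [hP v hv a ha, zero_smul, norm_zero]; positivity
    · rw [norm_smul]
      have h1 : ‖b.coord a v‖ ≤ K a * ‖v‖ := (b.coord a).toContinuousLinearMap.le_opNorm v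
      have h2 : ‖A k (b a)‖ ≤ Real.exp (N k * (c + ε / 2)) :=
        (hk₁ a).trans (Real.exp_le_exp.2 (mul_le_mul_of_nonneg_left (by linarith) hNk.le))
      calc _ ≤ K a * ‖v‖ * Real.exp (N k * (c + ε / 2)) := by gcongr
        _ = _ := by ring
  calc ‖A k v‖ = ‖∑ a, b.coord a v • A k (b a)‖ := by
        conv_lhs => rw [← b.sum_repr v, map_sum]
        simp only [map_smul, Module.Basis.coord_apply]
    _ ≤ ∑ a, K a * (Real.exp (N k * (c + ε / 2)) * ‖v‖) := norm_sum_le_of_le _ fun a _ => hterm a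
    _ = (∑ a, K a) * (Real.exp (N k * (c + ε / 2)) * ‖v‖) := (Finset.sum_mul ..).symm
    _ ≤ Real.exp (N k * (ε / 2)) * (Real.exp (N k * (c + ε / 2)) * ‖v‖) := by gcongr
    _ = _ := by rw [← mul_assoc, ← Real.exp_add]; ring_nf

variable [∀ k, FiniteDimensional ℝ (U k)]

/-- The coordinates in a regular basis are controlled, up to subexponential factors, by the norm of
the image. -/
theorem eventually_abs_coord_mul_exp_le (h : IsRegularBasis l N A b χ) {ε : ℝ} (hε : 0 < ε) :
    ∀ᶠ k in l, ∀ v a, |b.coord a v| * Real.exp (N k * (χ a - ε)) ≤ ‖A k v‖ := by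
  have hn : Module.finrank ℝ V = n := by simpa using Module.finrank_eq_card_basis b
  let o : OrthonormalBasis (Fin n) ℝ V := (stdOrthonormalBasis ℝ V).reindex (finCongr hn)
  set D : ℝ := |o.toBasis.det b| with hD
  have hDpos : 0 < D := abs_pos.2 (o.toBasis.isUnit_det b).ne_zero
  -- The losses are at most `n * δ` from the product of norms, one `δ` from the determinant and one
  -- from the constant `D`.
  obtain ⟨δ, hδ, hδε⟩ : ∃ δ > 0, (n + 2) * δ = ε :=
    ⟨ε / (n + 2), by positivity, by field_simp⟩
  have hup : ∀ᶠ k in l, ∀ a, ‖A k (b a)‖ ≤ Real.exp (N k * (χ a + δ)) :=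
    eventually_all.2 fun a => eventually_le_exp_of_tendsto h.tendsto_time (h.norm_basis_pos a)
      (h.exponent a) hδ
  filter_upwards [hup, eventually_exp_le_of_tendsto h.tendsto_time h.normDet_pos h.det hδ,
    eventually_le_exp_mul h.tendsto_time D⁻¹ hδ, h.tendsto_time.eventually_gt_atTop 0]
    with k hk₁ hk₂ hk₃ hNk v a
  have key := normDet_mul_abs_coord_le o (h.finrank_eq k) b (A k) a v
  have hprod : ∏ j ∈ Finset.univ.erase a, ‖A k (b j)‖ ≤
      Real.exp (N k * (∑ j, χ j - χ a + n * δ)) := by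
    calc ∏ j ∈ Finset.univ.erase a, ‖A k (b j)‖
        ≤ ∏ j ∈ Finset.univ.erase a, Real.exp (N k * (χ j + δ)) :=
          Finset.prod_le_prod (fun _ _ => norm_nonneg _) fun j _ => hk₁ j
      _ = Real.exp (N k * (∑ j ∈ Finset.univ.erase a, (χ j + δ))) := by
          rw [← Real.exp_sum, Finset.mul_sum]
      _ ≤ _ := by
          refine Real.exp_le_exp.2 (mul_le_mul_of_nonneg_left ?_ hNk.le)
          have h1 : ∑ j ∈ Finset.univ.erase a, (χ j + δ) + (χ a + δ) = ∑ j, (χ j + δ) :=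
            Finset.sum_erase_add _ _ (Finset.mem_univ a)
          rw [Finset.sum_add_distrib (s := Finset.univ)] at h1
          simp only [Finset.sum_const, Finset.card_univ, Fintype.card_fin, nsmul_eq_mul] at h1
          linarith
  have h1 : 1 ≤ D * Real.exp (N k * δ) := by
    rwa [inv_le_iff_one_le_mul₀' hDpos] at hk₃
  have hexp : Real.exp (N k * (χ a - ε)) * Real.exp (N k * (∑ j, χ j - χ a + n * δ)) *
      Real.exp (N k * δ) = Real.exp (N k * (∑ j, χ j - δ)) := by
    rw [← Real.exp_add, ← Real.exp_add, ← hδε]; ring_nf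
  set X := Real.exp (N k * (∑ j, χ j - χ a + n * δ)) with hX
  have hXpos : 0 < X := Real.exp_pos _
  refine le_of_mul_le_mul_right ?_ hXpos
  calc |b.coord a v| * Real.exp (N k * (χ a - ε)) * X
      ≤ |b.coord a v| * Real.exp (N k * (χ a - ε)) * X * (D * Real.exp (N k * δ)) :=
        le_mul_of_one_le_right (by positivity) h1
    _ = D * Real.exp (N k * (∑ j, χ j - δ)) * |b.coord a v| := by rw [← hexp]; ring
    _ ≤ D * (A k).normDet * |b.coord a v| := by gcongr
    _ ≤ ‖A k v‖ * ∏ j ∈ Finset.univ.erase a, ‖A k (b j)‖ := key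
    _ ≤ ‖A k v‖ * X := by gcongr

/-- A vector growing at most at the rate `c` has no component of exponent larger than `c`. -/
theorem coord_eq_zero [l.NeBot] (h : IsRegularBasis l N A b χ) {v : V} {c : ℝ}
    (hv : ∀ ε > 0, ∀ᶠ k in l, ‖A k v‖ ≤ Real.exp (N k * (c + ε))) {a : Fin n} (ha : c < χ a) :
    b.coord a v = 0 := by
  by_contra h0
  have hpos : 0 < |b.coord a v| := abs_pos.2 h0
  -- A nonzero coordinate would force `χ a - ε ≤ c + 2 * ε`, which a gap of `4 * ε` excludes.
  obtain ⟨ε, hε, hεc⟩ : ∃ ε > 0, c + 4 * ε = χ a := ⟨(χ a - c) / 4, by linarith, by ring⟩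
  obtain ⟨k, hk₁, hk₂, hk₃, hNk⟩ := ((h.eventually_abs_coord_mul_exp_le hε).and ((hv ε hε).and
    ((eventually_le_exp_mul h.tendsto_time |b.coord a v|⁻¹ hε).and
      (h.tendsto_time.eventually_gt_atTop 0)))).exists
  rw [inv_le_iff_one_le_mul₀' hpos] at hk₃
  have h1 := (hk₁ v a).trans hk₂
  have h2 : Real.exp (N k * (χ a - ε)) ≤ Real.exp (N k * (c + ε)) * Real.exp (N k * ε) := by
    calc Real.exp (N k * (χ a - ε)) ≤ Real.exp (N k * (χ a - ε)) *
          (|b.coord a v| * Real.exp (N k * ε)) := le_mul_of_one_le_right (Real.exp_pos _).le hk₃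
      _ = |b.coord a v| * Real.exp (N k * (χ a - ε)) * Real.exp (N k * ε) := by ring
      _ ≤ _ := by gcongr
  rw [← Real.exp_add, Real.exp_le_exp] at h2
  nlinarith

/-- Unlike the upper bound, this rests on the determinant: cancellation between the images of the
basis vectors is excluded by `eventually_abs_coord_mul_exp_le`. -/
theorem eventually_le_norm (h : IsRegularBasis l N A b χ) {P : Submodule ℝ V} {c : ℝ}
    (hP : ∀ v ∈ P, ∀ a, χ a < c → b.coord a v = 0) {ε : ℝ} (hε : 0 < ε) :
    ∀ᶠ k in l, ∀ v ∈ P, Real.exp (N k * (c - ε)) * ‖v‖ ≤ ‖A k v‖ := by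
  filter_upwards [h.eventually_abs_coord_mul_exp_le (half_pos hε),
    eventually_le_exp_mul h.tendsto_time (∑ a, ‖b a‖) (half_pos hε),
    h.tendsto_time.eventually_gt_atTop 0] with k hk₁ hk₂ hNk v hv
  have hterm : ∀ a, ‖b.coord a v • b a‖ * Real.exp (N k * (c - ε / 2)) ≤ ‖b a‖ * ‖A k v‖ := by
    intro a
    by_cases ha : χ a < c
    · rw [hP v hv a ha, zero_smul, norm_zero, zero_mul]; positivity
    · rw [norm_smul, Real.norm_eq_abs]
      have h2 : Real.exp (N k * (c - ε / 2)) ≤ Real.exp (N k * (χ a - ε / 2)) :=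
        Real.exp_le_exp.2 (mul_le_mul_of_nonneg_left (by linarith) hNk.le)
      calc |b.coord a v| * ‖b a‖ * Real.exp (N k * (c - ε / 2))
          ≤ |b.coord a v| * ‖b a‖ * Real.exp (N k * (χ a - ε / 2)) := by gcongr
        _ = ‖b a‖ * (|b.coord a v| * Real.exp (N k * (χ a - ε / 2))) := by ring
        _ ≤ _ := by gcongr; exact hk₁ v a
  have hsum : ‖v‖ * Real.exp (N k * (c - ε / 2)) ≤ Real.exp (N k * (ε / 2)) * ‖A k v‖ := by
    calc ‖v‖ * Real.exp (N k * (c - ε / 2))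
        = ‖∑ a, b.coord a v • b a‖ * Real.exp (N k * (c - ε / 2)) := by
          conv_lhs => rw [← b.sum_repr v]
          simp
      _ ≤ (∑ a, ‖b.coord a v • b a‖) * Real.exp (N k * (c - ε / 2)) := by
          gcongr; exact norm_sum_le _ _
      _ ≤ ∑ a, ‖b a‖ * ‖A k v‖ := by
          rw [Finset.sum_mul]; exact Finset.sum_le_sum fun a _ => hterm a
      _ ≤ _ := by rw [← Finset.sum_mul]; gcongr
  have he : Real.exp (N k * (c - ε / 2)) =
      Real.exp (N k * (ε / 2)) * Real.exp (N k * (c - ε)) := by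
    rw [← Real.exp_add]; ring_nf
  rw [he] at hsum
  refine le_of_mul_le_mul_left ?_ (Real.exp_pos (N k * (ε / 2)))
  linarith

/-- If the vectors of `E j` only have components of exponent `μ j`, then the singular values
of the restriction of `A k` to their direct sum `S` grow at the rates `μ j`, with multiplicities
`dim E j`. -/
theorem tendsto_log_singularValues (h : IsRegularBasis l N A b χ) {S : Submodule ℝ V} {p : ℕ}
    {E : Fin p → Submodule ℝ V} {μ : Fin p → ℝ} (hind : iSupIndep E) (hsup : ⨆ j, E j = S)
    (hE : ∀ j, ∀ u ∈ E j, ∀ a, χ a ≠ μ j → b.coord a u = 0) (i : Fin p) {t : ℕ}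
    (h₁ : ∑ j with μ i < μ j, Module.finrank ℝ (E j) ≤ t)
    (h₂ : t < ∑ j with μ i ≤ μ j, Module.finrank ℝ (E j)) :
    Tendsto (fun k => 1 / N k * Real.log (((A k).domRestrict S).singularValues t)) l
      (𝓝 (μ i)) := by
  have hle : ∀ s : Finset (Fin p), ⨆ j ∈ s, E j ≤ S := fun s =>
    hsup ▸ iSup₂_le fun j _ => le_iSup E j
  have hfin : ∀ s : Finset (Fin p),
      Module.finrank ℝ ((⨆ j ∈ s, E j).comap S.subtype) = ∑ j ∈ s, Module.finrank ℝ (E j) :=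
    fun s => by
      rw [← finrank_biSup_eq_sum hind s]
      exact (Submodule.comapSubtypeEquivOfLe (hle s)).finrank_eq
  have hS : Module.finrank ℝ S = ∑ j, Module.finrank ℝ (E j) := by
    rw [← finrank_biSup_eq_sum hind, ← hsup, ← Finset.sup_eq_iSup, Finset.sup_univ_eq_iSup]
  have hcoord : ∀ (s : Finset (Fin p)) (a : Fin n), (∀ j ∈ s, χ a ≠ μ j) →
      ∀ v ∈ ⨆ j ∈ s, E j, b.coord a v = 0 := fun s a ha v hv =>
    (iSup₂_le fun j hj u hu => hE j u hu a (ha j hj) :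
      ⨆ j ∈ s, E j ≤ LinearMap.ker (b.coord a)) hv
  refine tendsto_of_eventually_exp_le_of_le_exp h.tendsto_time (fun ε hε => ?_) fun ε hε => ?_
  · have hP := h.eventually_le_norm (P := ⨆ j ∈ Finset.univ.filter (μ i ≤ μ ·), E j) (c := μ i)
      (fun v hv a ha => hcoord _ a (fun j hj hj' => by
        have := (Finset.mem_filter.1 hj).2; linarith) v hv) hε
    filter_upwards [hP] with k hk
    exact le_singularValues_of_forall_le_norm ((A k).domRestrict S)
      ((⨆ j ∈ Finset.univ.filter (μ i ≤ μ ·), E j).comap S.subtype) (fun v hv => hk v hv)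
      (by rwa [hfin])
  · have hP := h.eventually_norm_le (P := ⨆ j ∈ Finset.univ.filter (¬ μ i < μ ·), E j) (c := μ i)
      (fun v hv a ha => hcoord _ a (fun j hj hj' => by
        have := (Finset.mem_filter.1 hj).2; linarith) v hv) hε
    filter_upwards [hP] with k hk
    refine singularValues_le_of_forall_norm_le ((A k).domRestrict S)
      ((⨆ j ∈ Finset.univ.filter (¬ μ i < μ ·), E j).comap S.subtype) (Real.exp_pos _).le
      (fun v hv => hk v hv) ?_
    -- Pieces of exponent above `μ i` have total dimension at most `t`, so the remaining ones have
    -- codimension at most `t` in `S`.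
    rw [hfin, hS, ← Finset.sum_filter_add_sum_filter_not Finset.univ (μ i < μ ·)]
    gcongr

end IsRegularBasis

end Growth

/-! ### Derivatives of the iterates and invariant distributions. -/

section Iterates

variable {m : ℕ} {M : Type*} [TopologicalSpace M] [ChartedSpace (EuclideanSpace ℝ (Fin m)) M]

/-- The map `f` is differentiable and `Df` maps the distribution `E` onto itself. -/
def Preserves (f : M → M) (E : ∀ x : M, Submodule ℝ (TangentSpace (𝓡 m) x)) : Prop :=
  MDifferentiable (𝓡 m) (𝓡 m) f ∧
    ∀ x, (E x).map (mfderiv (𝓡 m) (𝓡 m) f x).toLinearMap = E (f x)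

variable {E : ∀ x : M, Submodule ℝ (TangentSpace (𝓡 m) x)}

theorem Preserves.id : Preserves (id : M → M) E := by
  refine ⟨mdifferentiable_id, fun x => ?_⟩
  rw [mfderiv_id]
  exact Submodule.map_id _

theorem Preserves.comp {f g : M → M} (hg : Preserves g E) (hf : Preserves f E) :
    Preserves (g ∘ f) E := by
  refine ⟨hg.1.comp hf.1, fun x => ?_⟩
  rw [mfderiv_comp x (hg.1 (f x)) (hf.1 x)]
  refine (Submodule.map_comp _ _ _).trans ?_
  rw [hf.2 x]
  exact hg.2 (f x)

theorem Preserves.of_leftInverse {f g : M → M} (hf : Preserves f E)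
    (hg : MDifferentiable (𝓡 m) (𝓡 m) g) (hgf : g ∘ f = _root_.id)
    (hsurj : Function.Surjective f) : Preserves g E := by
  refine ⟨hg, fun y => ?_⟩
  obtain ⟨x, rfl⟩ := hsurj y
  -- The type of the derivative depends on the value of the map, so `g ∘ f = id` is substituted with
  -- the map as a variable.
  have h : ∀ h : M → M, h = _root_.id →
      (E x).map (mfderiv (𝓡 m) (𝓡 m) h x).toLinearMap = E (h x) := by
    rintro _ rfl
    exact Preserves.id.2 x
  have := h (g ∘ f) hgf
  rw [mfderiv_comp x (hg (f x)) (hf.1 x)] at this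
  rw [← hf.2 x]
  exact (Submodule.map_comp _ _ _).symm.trans this

theorem preserves_iter {φ : M ≃ₘ^2⟮𝓡 m, 𝓡 m⟯ M} (h : IsInvariantDistribution φ E) (k : ℤ) :
    Preserves (iter φ k) E := by
  have hφ : Preserves φ E := ⟨φ.mdifferentiable two_ne_zero, h⟩
  have hφ' : Preserves φ.symm E :=
    hφ.of_leftInverse (φ.symm.mdifferentiable two_ne_zero)
      (funext φ.symm_apply_apply) φ.surjective
  induction k using Int.induction_on with
  | zero => exact Preserves.id
  | succ k ih =>
    have : ⇑(iter φ (k + 1)) = iter φ k ∘ φ := by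
      unfold iter; rw [zpow_add_one]; rfl
    rw [this]
    exact ih.comp hφ
  | pred k ih =>
    have : ⇑(iter φ (-k - 1)) = iter φ (-k) ∘ φ.symm := by
      unfold iter; rw [zpow_sub_one]; rfl
    rw [this]
    exact ih.comp hφ'

/-- The zero distribution is always invariant, so `preserves_iter` applies to every `φ`. -/
theorem mdifferentiable_iter (φ : M ≃ₘ^2⟮𝓡 m, 𝓡 m⟯ M) (k : ℤ) :
    MDifferentiable (𝓡 m) (𝓡 m) (iter φ k) :=
  (preserves_iter (E := fun _ => ⊥) (φ := φ) (fun _ => Submodule.map_bot _) k).1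

theorem injective_Diter (φ : M ≃ₘ^2⟮𝓡 m, 𝓡 m⟯ M) (k : ℤ) (x : M) :
    Function.Injective (Diter φ k x) := by
  have hcomp : ⇑(iter φ (-k)) ∘ ⇑(iter φ k) = id := by
    funext y
    change (iter φ (-k) * iter φ k) y = y
    rw [iter, iter, zpow_neg, inv_mul_cancel, Equiv.Perm.one_apply]
  have h := mfderiv_comp x (mdifferentiable_iter φ (-k) (iter φ k x)) (mdifferentiable_iter φ k x)
  have hid : ∀ h : M → M, h = id → Function.Injective (mfderiv (𝓡 m) (𝓡 m) h x) := by
    rintro _ rfl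
    rw [mfderiv_id]
    exact fun _ _ h => h
  have h2 := hid _ hcomp
  rw [h] at h2
  exact Function.Injective.of_comp (f := mfderiv (𝓡 m) (𝓡 m) (iter φ (-k)) (iter φ k x)) h2

theorem Diter_mem {φ : M ≃ₘ^2⟮𝓡 m, 𝓡 m⟯ M} (h : IsInvariantDistribution φ E) (k : ℤ) {x : M}
    {v : TangentSpace (𝓡 m) x} (hv : v ∈ E x) : Diter φ k x v ∈ E (iter φ k x) := by
  rw [← (preserves_iter h k).2 x]
  exact Submodule.mem_map_of_mem hv

end Iterates

/-! ### Uniform bounds on the projections of a splitting. -/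

section Frames

/-- A family of vectors depending continuously on a point, which is linearly independent at `x₀`, is
uniformly linearly independent near `x₀`. -/
theorem eventually_norm_le_mul_norm_sum_smul {X 𝔼 ι : Type*} [TopologicalSpace X]
    [NormedAddCommGroup 𝔼] [NormedSpace ℝ 𝔼] [Fintype ι] {g : ι → X → 𝔼} {x₀ : X}
    (hg : ∀ i, ContinuousAt (g i) x₀) (hind : LinearIndependent ℝ fun i => g i x₀) :
    ∃ K C : ℝ, 0 ≤ K ∧ 0 ≤ C ∧ ∀ᶠ y in 𝓝 x₀, ∀ z : ι → ℝ,
      ‖z‖ ≤ K * ‖∑ i, z i • g i y‖ ∧ ‖∑ i, z i • g i y‖ ≤ C * ‖z‖ := by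
  let G : X → (ι → ℝ) →L[ℝ] 𝔼 := fun y =>
    ∑ i, (ContinuousLinearMap.proj (R := ℝ) (φ := fun _ : ι => ℝ) i).smulRight (g i y)
  have hGapp : ∀ y z, G y z = ∑ i, z i • g i y := fun y z => by
    simp [G]
  have hG : ContinuousAt G x₀ := by
    refine tendsto_finsetSum _ fun i _ => ?_
    exact (((ContinuousLinearMap.smulRightL ℝ (ι → ℝ) 𝔼
      (ContinuousLinearMap.proj (R := ℝ) (φ := fun _ : ι => ℝ) i)).continuous).continuousAt).comp
        (hg i)
  have hker : LinearMap.ker (G x₀).toLinearMap = ⊥ := by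
    refine LinearMap.ker_eq_bot'.2 fun z hz => ?_
    have hz' : ∑ i, z i • g i x₀ = 0 := (hGapp x₀ z).symm.trans hz
    exact funext fun i => Fintype.linearIndependent_iff.1 hind z hz' i
  obtain ⟨K, hKpos, hK⟩ := LinearMap.exists_antilipschitzWith _ hker
  have hK' : ∀ z, ‖z‖ ≤ (K : ℝ) * ‖G x₀ z‖ := hK.le_mul_norm (map_zero _)
  have hKpos' : (0 : ℝ) < K := by exact_mod_cast hKpos
  generalize (K : ℝ) = K at hK' hKpos'
  -- A perturbation of `G x₀` by less than `1 / (2 * K)` costs at most half of the lower bound `‖z‖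
  -- ≤ K * ‖G x₀ z‖`.
  have hδ : (0 : ℝ) < (2 * K)⁻¹ := by positivity
  refine ⟨2 * K, ‖G x₀‖ + (2 * K)⁻¹, by positivity, by positivity, ?_⟩
  filter_upwards [Metric.tendsto_nhds.1 hG _ hδ] with y hy z
  rw [dist_eq_norm] at hy
  rw [← hGapp]
  have h1 : ‖G y z - G x₀ z‖ ≤ (2 * K)⁻¹ * ‖z‖ :=
    ((G y - G x₀).le_opNorm z).trans (by gcongr)
  have h2 : ‖G x₀ z‖ ≤ ‖G y z‖ + ‖G y z - G x₀ z‖ := by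
    rw [add_comm]; simpa [norm_sub_rev] using norm_add_le (G x₀ z - G y z) (G y z)
  have h3 : ‖G y z‖ ≤ ‖G x₀ z‖ + ‖G y z - G x₀ z‖ := by
    simpa using norm_add_le (G x₀ z) (G y z - G x₀ z)
  constructor
  · have h4 : ‖z‖ ≤ K * (‖G y z‖ + (2 * K)⁻¹ * ‖z‖) := (hK' z).trans (by gcongr; linarith)
    have h5 : (K : ℝ) * ((2 * K)⁻¹ * ‖z‖) = ‖z‖ / 2 := by field_simp
    rw [mul_add, h5] at h4
    linarith
  · have := (G x₀).le_opNorm z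
    linarith

variable {m : ℕ} {M : Type*} [TopologicalSpace M] [ChartedSpace (EuclideanSpace ℝ (Fin m)) M]
  [IsManifold (𝓡 m) ∞ M] [RiemannianBundle (fun x : M => TangentSpace (𝓡 m) x)]
  {d r : ℕ} {E F : ∀ x : M, Submodule ℝ (TangentSpace (𝓡 m) x)}

/-- The projections of a `C¹` splitting are locally uniformly bounded. -/
theorem eventually_norm_le_mul_norm_add
    [IsContinuousRiemannianBundle (EuclideanSpace ℝ (Fin m))
      (fun x : M => TangentSpace (𝓡 m) x)]
    (hE : IsC1Distribution d E) (hF : IsC1Distribution r F) (hEF : ∀ x, IsCompl (E x) (F x))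
    (x₀ : M) :
    ∃ C : ℝ, ∀ᶠ y in 𝓝 x₀, ∀ u ∈ E y, ∀ w ∈ F y, ‖u‖ ≤ C * ‖u + w‖ := by
  obtain ⟨U₁, hU₁, hx₁, X, hX, hX'⟩ := hE x₀
  obtain ⟨U₂, hU₂, hx₂, Y, hY, hY'⟩ := hF x₀
  let e := trivializationAt (EuclideanSpace ℝ (Fin m)) (fun x : M => TangentSpace (𝓡 m) x) x₀
  have hx₀ : x₀ ∈ e.baseSet := mem_baseSet_trivializationAt _ _ x₀
  have hbase : e.baseSet ∈ 𝓝 x₀ := e.open_baseSet.mem_nhds hx₀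
  let Z : Fin d ⊕ Fin r → ∀ x : M, TangentSpace (𝓡 m) x := Sum.elim X Y
  have hZ : ∀ i, ContinuousAt (fun x => (⟨x, Z i x⟩ : TangentBundle (𝓡 m) M)) x₀ := by
    rintro (i | i)
    · exact (hX i).continuousOn.continuousAt (hU₁.mem_nhds hx₁)
    · exact (hY i).continuousOn.continuousAt (hU₂.mem_nhds hx₂)
  let g : Fin d ⊕ Fin r → M → EuclideanSpace ℝ (Fin m) := fun i y => (e ⟨y, Z i y⟩).2
  have hg : ∀ i, ContinuousAt (g i) x₀ := fun i =>
    ((FiberBundle.continuousAt_totalSpace (EuclideanSpace ℝ (Fin m)) _).1 (hZ i)).2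
  have hgapp : ∀ y ∈ e.baseSet, ∀ i, g i y = e.continuousLinearMapAt ℝ y (Z i y) :=
    fun y hy i => (e.continuousLinearMapAt_apply_of_mem ℝ hy _).symm
  have hind : LinearIndependent ℝ fun i => g i x₀ := by
    have h1 : LinearIndependent ℝ (Sum.elim (fun i => X i x₀) (fun i => Y i x₀)) :=
      (hX' x₀ hx₁).1.sum_type (hY' x₀ hx₂).1 (by
        rw [(hX' x₀ hx₁).2, (hY' x₀ hx₂).2]; exact (hEF x₀).disjoint)
    have h2 := h1.map' (e.continuousLinearMapAt ℝ x₀).toLinearMap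
      (LinearMap.ker_eq_bot.2
        (Function.LeftInverse.injective (e.symmL_continuousLinearMapAt (R := ℝ) hx₀)))
    have h3 : (fun i => g i x₀) = (e.continuousLinearMapAt ℝ x₀).toLinearMap ∘
        Sum.elim (fun i => X i x₀) (fun i => Y i x₀) := by
      funext i
      rw [hgapp x₀ hx₀]
      rcases i with i | i <;> rfl
    rw [h3]
    exact h2
  obtain ⟨K, C, hK0, hC0, hKC⟩ := eventually_norm_le_mul_norm_sum_smul hg hind
  obtain ⟨C₁, hC₁, h₁⟩ := eventually_norm_trivializationAt_lt (EuclideanSpace ℝ (Fin m))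
    (fun x : M => TangentSpace (𝓡 m) x) x₀
  obtain ⟨C₂, hC₂, h₂⟩ := eventually_norm_symmL_trivializationAt_lt (EuclideanSpace ℝ (Fin m))
    (fun x : M => TangentSpace (𝓡 m) x) x₀
  refine ⟨C₂ * (C * (K * C₁)), ?_⟩
  filter_upwards [hKC, h₁, h₂, hbase, hU₁.mem_nhds hx₁, hU₂.mem_nhds hx₂]
    with y hy hy₁ hy₂ hyb hyU₁ hyU₂ u hu w hw
  rw [← (hX' y hyU₁).2, Submodule.mem_span_range_iff_exists_fun] at hu
  rw [← (hY' y hyU₂).2, Submodule.mem_span_range_iff_exists_fun] at hw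
  obtain ⟨a, rfl⟩ := hu
  obtain ⟨c, rfl⟩ := hw
  set L := e.continuousLinearMapAt ℝ y with hL
  have hu : L (∑ i, a i • X i y) = ∑ i, (Sum.elim a 0 : Fin d ⊕ Fin r → ℝ) i • g i y := by
    simp [hgapp y hyb, Z, hL]
  have huw : L (∑ i, a i • X i y + ∑ i, c i • Y i y) =
      ∑ i, (Sum.elim a c : Fin d ⊕ Fin r → ℝ) i • g i y := by
    simp [hgapp y hyb, Z, hL]
  -- In frame coordinates the projection merely drops the `F`-coefficients, which does not increase
  -- the sup norm.
  have hle : ‖(Sum.elim a 0 : Fin d ⊕ Fin r → ℝ)‖ ≤ ‖(Sum.elim a c : Fin d ⊕ Fin r → ℝ)‖ := by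
    refine (pi_norm_le_iff_of_nonneg (norm_nonneg _)).2 ?_
    rintro (i | i)
    · exact norm_le_pi_norm (Sum.elim a c : Fin d ⊕ Fin r → ℝ) (Sum.inl i)
    · simp
  calc ‖∑ i, a i • X i y‖ = ‖e.symmL ℝ y (L (∑ i, a i • X i y))‖ := by
        rw [hL, e.symmL_continuousLinearMapAt hyb]
    _ ≤ C₂ * ‖L (∑ i, a i • X i y)‖ := (e.symmL ℝ y).le_of_opNorm_le hy₂.le _
    _ ≤ C₂ * (C * ‖(Sum.elim a c : Fin d ⊕ Fin r → ℝ)‖) := by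
        rw [hu]; gcongr; exact ((hy _).2).trans (by gcongr)
    _ ≤ C₂ * (C * (K * ‖L (∑ i, a i • X i y + ∑ i, c i • Y i y)‖)) := by
        rw [huw]; gcongr; exact (hy _).1
    _ ≤ C₂ * (C * (K * (C₁ * ‖∑ i, a i • X i y + ∑ i, c i • Y i y‖))) := by
        gcongr; exact L.le_of_opNorm_le hy₁.le _
    _ = _ := by ring

/-- The projections of a `C¹` splitting of the tangent bundle of a compact manifold are uniformly
bounded. -/
theorem exists_norm_le_mul_norm_add [CompactSpace M]
    [IsContinuousRiemannianBundle (EuclideanSpace ℝ (Fin m))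
      (fun x : M => TangentSpace (𝓡 m) x)]
    (hE : IsC1Distribution d E) (hF : IsC1Distribution r F) (hEF : ∀ x, IsCompl (E x) (F x)) :
    ∃ C : ℝ, ∀ y, ∀ u ∈ E y, ∀ w ∈ F y, ‖u‖ ≤ C * ‖u + w‖ := by
  have h := isCompact_univ.induction_on
    (p := fun s : Set M => ∃ C : ℝ, ∀ y ∈ s, ∀ u ∈ E y, ∀ w ∈ F y, ‖u‖ ≤ C * ‖u + w‖)
    ⟨0, by simp⟩ (fun s t hst ⟨C, hC⟩ => ⟨C, fun y hy => hC y (hst hy)⟩)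
    (fun s t ⟨C₁, h₁⟩ ⟨C₂, h₂⟩ => ⟨max C₁ C₂, fun y hy u hu w hw => by
      rcases hy with hy | hy
      · exact (h₁ y hy u hu w hw).trans (by gcongr; exact le_max_left _ _)
      · exact (h₂ y hy u hu w hw).trans (by gcongr; exact le_max_right _ _)⟩)
    (fun x _ => by
      obtain ⟨C, hC⟩ := eventually_norm_le_mul_norm_add hE hF hEF x
      exact ⟨_, mem_nhdsWithin_of_mem_nhds hC, C, fun y hy => hy⟩)
  simpa using h

end Frames

/-- A direct sum decomposition has an adapted basis. -/
theorem exists_adapted_basis {V : Type*} [AddCommGroup V] [Module ℝ V] [FiniteDimensional ℝ V]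
    {n p : ℕ} (hn : Module.finrank ℝ V = n) {W : Fin p → Submodule ℝ V} (hind : iSupIndep W)
    (hsup : ⨆ j, W j = ⊤) :
    ∃ (b : Module.Basis (Fin n) ℝ V) (τ : Fin n → Fin p), (∀ a, b a ∈ W (τ a)) ∧
      ∀ χ : Fin p → ℝ, ∑ a, χ (τ a) = ∑ j, χ j * (Module.finrank ℝ (W j) : ℝ) := by
  have hint := DirectSum.isInternal_submodule_of_iSupIndep_of_iSup_eq_top hind hsup
  let B := hint.collectedBasis fun j => Module.finBasis ℝ (W j)
  have hcard : Fintype.card (Σ j, Fin (Module.finrank ℝ (W j))) = n := by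
    rw [← hn, Module.finrank_eq_card_basis B]
  let e := Fintype.equivFinOfCardEq hcard
  refine ⟨B.reindex e, fun a => (e.symm a).1, fun a => ?_, fun χ => ?_⟩
  · rw [Module.Basis.reindex_apply]
    exact hint.collectedBasis_mem _ _
  · rw [e.symm.sum_comp (fun s => χ s.1), Fintype.sum_sigma]
    simp [mul_comm]

/-- A vector whose coordinates in an adapted basis vanish outside of the `j`-th block belongs to
the `j`-th subspace. -/
theorem mem_of_coord_eq_zero {V : Type*} [AddCommGroup V] [Module ℝ V] {n p : ℕ}
    {W : Fin p → Submodule ℝ V} {b : Module.Basis (Fin n) ℝ V} {τ : Fin n → Fin p}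
    (hb : ∀ a, b a ∈ W (τ a)) {j : Fin p} {v : V} (hv : ∀ a, τ a ≠ j → b.coord a v = 0) :
    v ∈ W j := by
  rw [← b.sum_repr v]
  refine Submodule.sum_mem _ fun a _ => ?_
  by_cases ha : τ a = j
  · exact Submodule.smul_mem _ _ (ha ▸ hb a)
  · have : b.repr v a = 0 := hv a ha
    rw [this, zero_smul]
    exact Submodule.zero_mem _

theorem eventually_le_exp_of_le_const_mul {κ : Type*} {l : Filter κ} {N f g : κ → ℝ} {c C : ℝ}
    (hN : Tendsto N l atTop) (hf₀ : ∀ k, 0 ≤ f k) (hgf : ∀ k, g k ≤ C * f k)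
    (hf : ∀ ε > 0, ∀ᶠ k in l, f k ≤ Real.exp (N k * (c + ε))) :
    ∀ ε > 0, ∀ᶠ k in l, g k ≤ Real.exp (N k * (c + ε)) := by
  intro ε hε
  filter_upwards [hf _ (half_pos hε), eventually_le_exp_mul hN C (half_pos hε)] with k h₁ h₂
  calc g k ≤ C * f k := hgf k
    _ ≤ Real.exp (N k * (ε / 2)) * Real.exp (N k * (c + ε / 2)) :=
        mul_le_mul h₂ h₁ (hf₀ k) (Real.exp_pos _).le
    _ = _ := by rw [← Real.exp_add]; ring_nf

/-! ### Oseledets splittings and singular values at regular points. -/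

section Main

variable {m : ℕ} {M : Type*} [TopologicalSpace M] [ChartedSpace (EuclideanSpace ℝ (Fin m)) M]
  [RiemannianBundle (fun x : M => TangentSpace (𝓡 m) x)]
  {φ : M ≃ₘ^2⟮𝓡 m, 𝓡 m⟯ M} {x : M}

/-- The vector `v` grows at most at the rate `c` in the future and at most at the rate `-c` in the
past. -/
def GrowsAtMost (φ : M ≃ₘ^2⟮𝓡 m, 𝓡 m⟯ M) (x : M) (v : TangentSpace (𝓡 m) x) (c : ℝ) : Prop :=
  (∀ ε > 0, ∀ᶠ k : ℤ in atTop, ‖Diter φ k x v‖ ≤ Real.exp ((k : ℝ) * (c + ε))) ∧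
    ∀ ε > 0, ∀ᶠ k : ℤ in atBot, ‖Diter φ k x v‖ ≤ Real.exp (-(k : ℝ) * (-c + ε))

theorem tendsto_neg_intCast_atBot : Tendsto (fun k : ℤ => -(k : ℝ)) atBot atTop :=
  tendsto_neg_atBot_atTop.comp (tendsto_intCast_atBot_iff.2 tendsto_id)

theorem tendsto_neg_time {f : ℤ → ℝ} {c : ℝ} {l : Filter ℤ} :
    Tendsto (fun k : ℤ => 1 / -(k : ℝ) * f k) l (𝓝 (-c)) ↔
      Tendsto (fun k : ℤ => 1 / (k : ℝ) * f k) l (𝓝 c) := by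
  have : (fun k : ℤ => 1 / -(k : ℝ) * f k) = fun k : ℤ => -(1 / (k : ℝ) * f k) := by
    funext k; rw [div_neg, neg_mul]
  rw [this, tendsto_neg_iff]

theorem norm_Diter_pos {v : TangentSpace (𝓡 m) x} (hv : v ≠ 0) (k : ℤ) : 0 < ‖Diter φ k x v‖ :=
  norm_pos_iff.2 ((map_ne_zero_iff _ (injective_Diter φ k x)).2 hv)

theorem HasLyapunovExponent.growsAtMost {v : TangentSpace (𝓡 m) x} {c : ℝ} (hv : v ≠ 0)
    (h : HasLyapunovExponent φ x v c) : GrowsAtMost φ x v c :=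
  ⟨fun _ hε => eventually_le_exp_of_tendsto tendsto_intCast_atTop_atTop (norm_Diter_pos hv) h.1 hε,
    fun _ hε => eventually_le_exp_of_tendsto tendsto_neg_intCast_atBot (norm_Diter_pos hv)
      (tendsto_neg_time.2 h.2) hε⟩

theorem GrowsAtMost.of_le {v w : TangentSpace (𝓡 m) x} {c C : ℝ} (hw : GrowsAtMost φ x w c)
    (h : ∀ k, ‖Diter φ k x v‖ ≤ C * ‖Diter φ k x w‖) : GrowsAtMost φ x v c :=
  ⟨eventually_le_exp_of_le_const_mul tendsto_intCast_atTop_atTop (fun _ => norm_nonneg _) h hw.1,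
    eventually_le_exp_of_le_const_mul tendsto_neg_intCast_atBot (fun _ => norm_nonneg _) h hw.2⟩

/-- At a Lyapunov regular point there is a basis, adapted to the Oseledets splitting, which is
regular both in the future and in the past. -/
theorem exists_isRegularBasis {p : ℕ} {W : Fin p → Submodule ℝ (TangentSpace (𝓡 m) x)}
    {χ : Fin p → ℝ} (hW : IsOseledetsSplitting φ x ⊤ W χ)
    (hdet : TendstoBothEnds (fun k => 1 / (k : ℝ) * Real.log (Diter φ k x).normDet)
      (∑ j, χ j * (Module.finrank ℝ (W j) : ℝ))) :
    ∃ (b : Module.Basis (Fin m) ℝ (TangentSpace (𝓡 m) x)) (τ : Fin m → Fin p),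
      (∀ a, b a ∈ W (τ a)) ∧
      IsRegularBasis atTop (fun k : ℤ => (k : ℝ)) (fun k => Diter φ k x) b (fun a => χ (τ a)) ∧
      IsRegularBasis atBot (fun k : ℤ => -(k : ℝ)) (fun k => Diter φ k x) b
        (fun a => -χ (τ a)) := by
  have hfin : ∀ y : M, Module.finrank ℝ (TangentSpace (𝓡 m) y) = m := fun _ =>
    finrank_euclideanSpace_fin (𝕜 := ℝ)
  obtain ⟨b, τ, hb, hsum⟩ := exists_adapted_basis (hfin x) hW.iSupIndep hW.iSup_eq
  have hexp : ∀ a, HasLyapunovExponent φ x (b a) (χ (τ a)) := fun a =>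
    hW.exponent _ _ (hb a) (b.ne_zero a)
  refine ⟨b, τ, hb, ⟨tendsto_intCast_atTop_atTop, fun k => injective_Diter φ k x, fun _ => hfin _,
    fun a => (hexp a).1, ?_⟩, ⟨tendsto_neg_intCast_atBot, fun k => injective_Diter φ k x,
    fun _ => hfin _, fun a => tendsto_neg_time.2 (hexp a).2, ?_⟩⟩
  · rw [hsum]; exact hdet.1
  · rw [Finset.sum_neg_distrib, hsum]; exact tendsto_neg_time.2 hdet.2

/-- A vector growing at most at the rate `c` has only components of exponent `c`. -/
theorem GrowsAtMost.coord_eq_zero {b : Module.Basis (Fin m) ℝ (TangentSpace (𝓡 m) x)}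
    {χ : Fin m → ℝ}
    (h₁ : IsRegularBasis atTop (fun k : ℤ => (k : ℝ)) (fun k => Diter φ k x) b χ)
    (h₂ : IsRegularBasis atBot (fun k : ℤ => -(k : ℝ)) (fun k => Diter φ k x) b (fun a => -χ a))
    {v : TangentSpace (𝓡 m) x} {c : ℝ} (hv : GrowsAtMost φ x v c) {a : Fin m} (ha : χ a ≠ c) :
    b.coord a v = 0 := by
  -- Exponents below `c` are excluded by the past, where signs are reversed, and those above `c` by
  -- the future.
  rcases ha.lt_or_gt with ha | ha
  · exact h₂.coord_eq_zero hv.2 (neg_lt_neg ha)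
  · exact h₁.coord_eq_zero hv.1 ha

/-- The intersections of the Oseledets subspaces at a regular point with an invariant distribution
having an invariant complement at a bounded angle form an Oseledets splitting of it. -/
theorem exists_isOseledetsSplitting_of_bounded
    {E F : ∀ x : M, Submodule ℝ (TangentSpace (𝓡 m) x)}
    (hEF : ∀ x, IsCompl (E x) (F x)) (hEinv : IsInvariantDistribution φ E)
    (hFinv : IsInvariantDistribution φ F) {C : ℝ}
    (hC : ∀ y, ∀ u ∈ E y, ∀ w ∈ F y, ‖u‖ ≤ C * ‖u + w‖) (hx : IsLyapunovRegular φ x) :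
    ∃ (n : ℕ) (Eb : Fin n → Submodule ℝ (TangentSpace (𝓡 m) x)) (lam : Fin n → ℝ),
      IsOseledetsSplitting φ x (E x) Eb lam := by
  classical
  obtain ⟨p, W, χ, hW, hdet⟩ := hx
  obtain ⟨b, τ, hb, h₁, h₂⟩ := exists_isRegularBasis hW hdet
  have hbEF : ∀ a, ∃ u ∈ E x, ∃ w ∈ F x, u + w = b a := fun a =>
    Submodule.mem_sup.1 ((hEF x).sup_eq_top ▸ Submodule.mem_top)
  choose u hu w hw huw using hbEF
  have huW : ∀ a, u a ∈ W (τ a) := by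
    intro a
    have hg : GrowsAtMost φ x (u a) (χ (τ a)) := by
      refine ((hW.exponent _ _ (hb a) (b.ne_zero a)).growsAtMost (b.ne_zero a)).of_le (C := C)
        fun k => ?_
      -- By invariance the image of `u a` is the `E`-component of the image of `b a`, so the uniform
      -- projection bound applies at `φ^k(x)`.
      rw [← huw a, map_add]
      exact hC _ _ (Diter_mem hEinv k (hu a)) _ (Diter_mem hFinv k (hw a))
    exact mem_of_coord_eq_zero hb fun a' ha' =>
      hg.coord_eq_zero h₁ h₂ (hW.strictMono.injective.ne ha')
  have hle : E x ≤ ⨆ j, E x ⊓ W j := by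
    intro v hv
    -- Both sides lie in `E x ⊓ F x = ⊥`, so `v` is a combination of the `u a` alone.
    have hsum : v - ∑ a, b.repr v a • u a = ∑ a, b.repr v a • w a := by
      rw [sub_eq_iff_eq_add', ← Finset.sum_add_distrib]
      conv_lhs => rw [← b.sum_repr v]
      exact Finset.sum_congr rfl fun a _ => by rw [← huw a, smul_add]
    have hE : v - ∑ a, b.repr v a • u a ∈ E x :=
      Submodule.sub_mem _ hv (Submodule.sum_mem _ fun a _ => Submodule.smul_mem _ _ (hu a))
    have hF : v - ∑ a, b.repr v a • u a ∈ F x := by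
      rw [hsum]
      exact Submodule.sum_mem _ fun a _ => Submodule.smul_mem _ _ (hw a)
    rw [sub_eq_zero.1 (Submodule.disjoint_def.1 (hEF x).disjoint _ hE hF)]
    exact Submodule.sum_mem _ fun a _ => Submodule.smul_mem _ _
      (Submodule.mem_iSup_of_mem (τ a) ⟨hu a, huW a⟩)
  -- An Oseledets splitting has nonzero summands: the zero intersections are discarded and the rest
  -- renumbered in increasing order.
  let J : Finset (Fin p) := Finset.univ.filter fun j => E x ⊓ W j ≠ ⊥
  let ν : Fin J.card ↪o Fin p := J.orderEmbOfFin rfl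
  refine ⟨J.card, fun i => E x ⊓ W (ν i), fun i => χ (ν i), ⟨?_, ?_, ?_, ?_, ?_⟩⟩
  · exact hW.strictMono.comp ν.strictMono
  · exact fun i => (Finset.mem_filter.1 (J.orderEmbOfFin_mem rfl i)).2
  · exact (hW.iSupIndep.comp ν.injective).mono fun i => inf_le_right
  · refine le_antisymm (iSup_le fun i => inf_le_left) (hle.trans (iSup_le fun j => ?_))
    by_cases hj : E x ⊓ W j = ⊥
    · rw [hj]; exact bot_le
    · have hjJ : j ∈ Set.range ν := by
        rw [Finset.range_orderEmbOfFin]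
        simpa [J] using hj
      obtain ⟨i, rfl⟩ := hjJ
      exact le_iSup (fun i => E x ⊓ W (ν i)) i
  · exact fun i v hv => hW.exponent _ v hv.2

/-- At a Lyapunov regular point, the exponents of the singular values of the derivative restricted
to a subspace are those of any Oseledets splitting of the subspace. -/
theorem IsOseledetsSplitting.tendsto_log_singVal (hx : IsLyapunovRegular φ x)
    {S : Submodule ℝ (TangentSpace (𝓡 m) x)} {n : ℕ}
    {Eb : Fin n → Submodule ℝ (TangentSpace (𝓡 m) x)} {lam : Fin n → ℝ}
    (hE : IsOseledetsSplitting φ x S Eb lam) (i : Fin n) {ℓ : ℕ}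
    (hℓ₁ : ∑ j ∈ Finset.Iio i, Module.finrank ℝ (Eb j) < ℓ)
    (hℓ₂ : ℓ ≤ ∑ j ∈ Finset.Iic i, Module.finrank ℝ (Eb j)) :
    TendstoBothEnds (fun k => 1 / (k : ℝ) * Real.log (singVal φ x S k ℓ)) (lam i) := by
  obtain ⟨p, W, χ, hW, hdet⟩ := hx
  obtain ⟨b, τ, hb, h₁, h₂⟩ := exists_isRegularBasis hW hdet
  have hsupp : ∀ j, ∀ u ∈ Eb j, ∀ a, χ (τ a) ≠ lam j → b.coord a u = 0 := by
    intro j u hu a ha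
    rcases eq_or_ne u 0 with rfl | hu0
    · exact map_zero _
    · exact ((hE.exponent j u hu hu0).growsAtMost hu0).coord_eq_zero h₁ h₂ ha
  have hS : Module.finrank ℝ S = ∑ j, Module.finrank ℝ (Eb j) := by
    rw [← finrank_biSup_eq_sum hE.iSupIndep, ← hE.iSup_eq, ← Finset.sup_eq_iSup,
      Finset.sup_univ_eq_iSup]
  have hIio : Finset.univ.filter (fun j => j < i) = Finset.Iio i := by ext; simp
  have hIic : Finset.univ.filter (fun j => j ≤ i) = Finset.Iic i := by ext; simp
  constructor
  · have hsplit₁ := Finset.sum_filter_add_sum_filter_not Finset.univ (· ≤ i)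
      fun j => Module.finrank ℝ (Eb j)
    have hsplit₂ := Finset.sum_filter_add_sum_filter_not Finset.univ (· < i)
      fun j => Module.finrank ℝ (Eb j)
    rw [hIic] at hsplit₁
    rw [hIio] at hsplit₂
    simp only [not_le] at hsplit₁
    simp only [not_lt] at hsplit₂
    -- The increasing index `ℓ` is position `finrank S - ℓ` in the decreasing list numbered from
    -- zero.
    have key := h₁.tendsto_log_singularValues hE.iSupIndep hE.iSup_eq hsupp i
      (t := Module.finrank ℝ S - ℓ) (by simp only [hE.strictMono.lt_iff_lt]; omega)
      (by simp only [hE.strictMono.le_iff_le]; omega)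
    refine key.congr' ?_
    filter_upwards [eventually_ge_atTop 0] with k hk
    rw [singVal, if_pos hk]
  -- In the past the rates `-lam j` decrease with `j`, so the decreasing list already has the
  -- required order; `ℓ - 1` only shifts the numbering to start at zero.
  · have key := h₂.tendsto_log_singularValues (μ := fun j => -lam j) hE.iSupIndep hE.iSup_eq
      (fun j u hu a ha => hsupp j u hu a fun h => ha (congrArg _ h)) i (t := ℓ - 1)
      (by simp only [neg_lt_neg_iff, hE.strictMono.lt_iff_lt, hIio]; omega)
      (by simp only [neg_le_neg_iff, hE.strictMono.le_iff_le, hIic]; omega)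
    refine (tendsto_neg_time.1 key).congr' ?_
    filter_upwards [eventually_lt_atBot 0] with k hk
    rw [singVal, if_neg (not_le.2 hk)]

end Main

end LyapunovSing

theorem mainTheorem5 {m : ℕ} {M : Type*} [TopologicalSpace M] [T2Space M] [CompactSpace M]
    [ChartedSpace (EuclideanSpace ℝ (Fin m)) M] [IsManifold (𝓡 m) ∞ M]
    [RiemannianBundle (fun x : M => TangentSpace (𝓡 m) x)]
    [IsContMDiffRiemannianBundle (𝓡 m) ∞ (EuclideanSpace ℝ (Fin m))
      (fun x : M => TangentSpace (𝓡 m) x)]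
    (φ : M ≃ₘ^2⟮𝓡 m, 𝓡 m⟯ M)
    (d r : ℕ) (E F : ∀ x : M, Submodule ℝ (TangentSpace (𝓡 m) x))
    (hE : LyapunovSing.IsC1Distribution d E) (hF : LyapunovSing.IsC1Distribution r F)
    (hEF : ∀ x, IsCompl (E x) (F x))
    (hEinv : LyapunovSing.IsInvariantDistribution φ E)
    (hFinv : LyapunovSing.IsInvariantDistribution φ F)
    (x : M) (hx : LyapunovSing.IsLyapunovRegular φ x) :
    (∃ (n : ℕ) (Eb : Fin n → Submodule ℝ (TangentSpace (𝓡 m) x)) (lam : Fin n → ℝ),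
      LyapunovSing.IsOseledetsSplitting φ x (E x) Eb lam) ∧
    ∀ (n : ℕ) (Eb : Fin n → Submodule ℝ (TangentSpace (𝓡 m) x)) (lam : Fin n → ℝ),
      LyapunovSing.IsOseledetsSplitting φ x (E x) Eb lam →
      ∀ (i : Fin n) (ℓ : ℕ),
        ∑ j ∈ Finset.Iio i, Module.finrank ℝ (Eb j) < ℓ →
        ℓ ≤ ∑ j ∈ Finset.Iic i, Module.finrank ℝ (Eb j) →
        LyapunovSing.TendstoBothEnds
          (fun k => 1 / (k : ℝ) * Real.log (LyapunovSing.singVal φ x (E x) k ℓ)) (lam i) := by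
  have : IsContinuousRiemannianBundle (EuclideanSpace ℝ (Fin m))
      (fun x : M => TangentSpace (𝓡 m) x) := by
    obtain ⟨g, hg, hg'⟩ := IsContMDiffRiemannianBundle.exists_contMDiff (IB := 𝓡 m) (n := ∞)
      (F := EuclideanSpace ℝ (Fin m)) (E := fun x : M => TangentSpace (𝓡 m) x)
    exact ⟨g, hg.continuous, hg'⟩
  obtain ⟨C, hC⟩ := LyapunovSing.exists_norm_le_mul_norm_add hE hF hEF
  exact ⟨LyapunovSing.exists_isOseledetsSplitting_of_bounded hEF hEinv hFinv hC hx,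
    fun n Eb lam h i ℓ h₁ h₂ => h.tendsto_log_singVal hx i h₁ h₂⟩
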